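/- Let $\mathcal C$ be a category with pullbacks and coequalizers of reflexive pairs, such that these coequalizers are stable under pullback, and let $\mathbb T=(T,\eta,\mu)$ be a monad on $\mathcal C$ whose endofunctor $T$ preserves coequalizers of reflexive pairs. A $\mathbb T$-category $A$ (in the sense of Burroni) consists of a span $TA_0\xleftarrow{d_0}A_1\xrightarrow{c_0}A_0$ in $\mathcal C$, a morphism $i:A_0\to A_1$ with $d_0 i=\eta_{A_0}$ and $c_0 i=1$, and a composition $m:A_2\to A_1$, where $A_2=TA_1\times_{TA_0}A_1$ is the pullback of $Tc_0$ and $d_0$ with projections $d_1:A_2\to TA_1$, $c_1:A_2\to A_1$, such that $d_0m=\mu_{A_0}\cdot Td_0\cdot d_1$, $c_0m=c_0c_1$, $m\cdot(Ti\times 1_{A_1})=1_{A_1}=m\cdot(\eta_{A_1}\times i)$ and, on $A_3=TA_2\times_{TA_1}A_2$ (the pullback of $Tc_1$ and $d_1$, with projections $d_2:A_3\to TA_2$, $c_2:A_3\to A_2$), $m\cdot m_1=m\cdot m_2$, where $m_1,m_2:A_3\to A_2$ are determined by $d_1m_1=Tm\cdot d_2$, $c_1m_1=c_1c_2$, $d_1m_2=\mu_{A_1}\cdot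 Td_1\cdot d_2$, $c_1m_2=m\,c_2$. A $\mathbb T$-functor $f=(f_0,f_1):A\to B$ is a pair of morphisms $f_0:A_0\to B_0$, $f_1:A_1\to B_1$ compatible with $d_0,c_0,i,m$. These form the category $\mathsf{Cat}(\mathbb T)$. A $\mathbb T$-category is ordered if its span $(d_0,c_0)$ is jointly monic; $\mathsf{Ord}(\mathbb T)$ is the full subcategory of ordered $\mathbb T$-categories. A $\mathbb T$-functor $f:A\to B$ is perfect if the square $Tf_0\cdot d_0^A=d_0^B\cdot f_1$ is a pullback in $\mathcal C$, and initial if it is left orthogonal in $\mathsf{Cat}(\mathbb T)$ to all perfect $\mathbb T$-functors (every commutative square from it to a perfect $\mathbb T$-functor has a unique fill-in). A comprehensive factorization of a $\mathbb T$-functor $f$ is a factorization $f=p\cdot e$ in $\mathsf{Cat}(\mathbb T)$ with $e$ initial and $p$ perfect. Then the following hold. 1. Every $\mathbb T$-functor $f:A\to B$ between ordered $\mathbb T$-categories has a comprehensive factorization $A\xrightarrow{e}P\xrightarrow{p}B$ in $\mathsf{Cat}(\mathbb T)$, and in every such factorization the $\mathbb T$-category $P$ is ordered. 2. The initial and the perfect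 $\mathbb T$-functors between ordered $\mathbb T$-categories form an orthogonal factorization system of $\mathsf{Ord}(\mathbb T)$. 3. $\mathsf{Cat}(\mathbb T)$ has pullbacks, and $\mathsf{Ord}(\mathbb T)$ is closed under pullbacks in $\mathsf{Cat}(\mathbb T)$. 4. If $p:P\to B$ is a perfect $\mathbb T$-functor and $B$ is ordered, then $P$ is ordered. -/

import Mathlib

open CategoryTheory CategoryTheory.Limits

universe v u

namespace Burroni

section General

variable {C : Type u} [Category.{v} C]

/-- Orthogonality `e ⊥ n`: every commutative square from `e` to `n` has exactly one fill-in. -/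
def Orthogonal {A B D E : C} (e : A ⟶ B) (n : D ⟶ E) : Prop :=
  ∀ (a : A ⟶ D) (b : B ⟶ E), a ≫ n = e ≫ b → ∃! w : B ⟶ D, e ≫ w = a ∧ w ≫ n = b

/-- `(E, M)` is an orthogonal factorization system of the category `C`: both classes are closed
under composition with isomorphisms (on either side), every morphism of `C` is a morphism of `E`
followed by one of `M`, and every morphism of `E` is orthogonal to every morphism of `M`. -/
structure IsOrthogonalFactorizationSystem (E M : MorphismProperty C) : Prop where
  left_respectsIso : E.RespectsIso
  right_respectsIso : M.RespectsIso
  factorization : ∀ {A B : C} (f : A ⟶ B),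
    ∃ (P : C) (e : A ⟶ P) (m : P ⟶ B), E e ∧ M m ∧ e ≫ m = f
  orthogonal : ∀ {A P D B : C} (e : A ⟶ P) (m : D ⟶ B), E e → M m → Orthogonal e m

variable (C) in
/-- Coequalizers of reflexive pairs in `C` are stable under pullback: if `z : Y ⟶ Q` is a
coequalizer of a reflexive pair `f, g : X ⟶ Y`, then for every `h : R ⟶ Q` the pullback
`z' : Y' ⟶ R` of `z` along `h` is a coequalizer of the pair `f', g' : X' ⟶ Y'` obtained by pulling
back `f` and `g`, regarded as morphisms over `Q`, along `h`. -/
def ReflexiveCoequalizersPullbackStable : Prop :=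
  ∀ ⦃X Y Q : C⦄ (f g : X ⟶ Y) [IsReflexivePair f g] (z : Y ⟶ Q) (w : f ≫ z = g ≫ z),
    Nonempty (IsColimit (Cofork.ofπ z w)) →
    ∀ ⦃R : C⦄ (h : R ⟶ Q)
      ⦃Y' : C⦄ (y : Y' ⟶ Y) (z' : Y' ⟶ R), IsPullback y z' z h →
      ∀ ⦃X' : C⦄ (x : X' ⟶ X) (x' : X' ⟶ R), IsPullback x x' (f ≫ z) h →
      ∀ (f' g' : X' ⟶ Y'), f' ≫ y = x ≫ f → f' ≫ z' = x' → g' ≫ y = x ≫ g → g' ≫ z' = x' →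
      ∀ (w' : f' ≫ z' = g' ≫ z'), Nonempty (IsColimit (Cofork.ofπ z' w'))

end General

noncomputable section

variable {C : Type u} [Category.{v} C]

/-- A `T`-graph: a span `T A₀ ⟵ A₁ ⟶ A₀`. -/
structure TGraph (T : CategoryTheory.Monad C) where
  /-- the object `A₀` of objects -/
  ob : C
  /-- the object `A₁` of morphisms -/
  mor : C
  /-- the domain morphism `d₀` -/
  dom : mor ⟶ T.obj ob
  /-- the codomain morphism `c₀` -/
  cod : mor ⟶ ob

/-- A pointed `T`-graph: a `T`-graph with an insertion of identities `i : A₀ ⟶ A₁`. -/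
structure PointedTGraph (T : CategoryTheory.Monad C) extends TGraph T where
  /-- the insertion of identities -/
  ins : ob ⟶ mor
  ins_dom : ins ≫ dom = T.η.app ob
  ins_cod : ins ≫ cod = 𝟙 ob

variable [HasPullbacks C] {T : CategoryTheory.Monad C}

namespace TGraph

variable (A : TGraph T)

/-- The object `A₂ = T A₁ ×_{T A₀} A₁` of composable pairs. -/
abbrev pairs : C := pullback (T.map A.cod) A.dom

/-- `d₁ : A₂ ⟶ T A₁` -/
abbrev d₁ : A.pairs ⟶ T.obj A.mor := pullback.fst (T.map A.cod) A.dom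

/-- `c₁ : A₂ ⟶ A₁` -/
abbrev c₁ : A.pairs ⟶ A.mor := pullback.snd (T.map A.cod) A.dom

/-- The object `A₃ = T A₂ ×_{T A₁} A₂` of composable triples. -/
abbrev triples : C := pullback (T.map A.c₁) A.d₁

/-- `d₂ : A₃ ⟶ T A₂` -/
abbrev d₂ : A.triples ⟶ T.obj A.pairs := pullback.fst (T.map A.c₁) A.d₁

/-- `c₂ : A₃ ⟶ A₂` -/
abbrev c₂ : A.triples ⟶ A.pairs := pullback.snd (T.map A.c₁) A.d₁

end TGraph

namespace PointedTGraph

variable (A : PointedTGraph T)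

/-- `i₁ = T i × 1 : A₁ ⟶ A₂` -/
def i₁ : A.mor ⟶ A.pairs :=
  pullback.lift (A.dom ≫ T.map A.ins) (𝟙 A.mor) (by
    rw [Category.assoc, ← T.map_comp, A.ins_cod, T.map_id, Category.comp_id, Category.id_comp])

/-- `i₂ = η × i : A₁ ⟶ A₂` -/
def i₂ : A.mor ⟶ A.pairs :=
  pullback.lift (T.η.app A.mor) (A.cod ≫ A.ins) (by
    rw [Category.assoc, A.ins_dom]; exact (T.η.naturality A.cod).symm)

end PointedTGraph

/-- `m₁ = T m × c₁ : A₃ ⟶ A₂`, for a morphism `m : A₂ ⟶ A₁` with `c₀ m = c₀ c₁`. -/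
def TGraph.m₁ (A : TGraph T) (m : A.pairs ⟶ A.mor) (hcod : m ≫ A.cod = A.c₁ ≫ A.cod) :
    A.triples ⟶ A.pairs :=
  pullback.lift (A.d₂ ≫ T.map m) (A.c₂ ≫ A.c₁) (by
    rw [Category.assoc, Category.assoc, ← T.map_comp, hcod, T.map_comp, ← Category.assoc,
      pullback.condition, Category.assoc, pullback.condition])

/-- `m₂ = (μ · T d₁) × m : A₃ ⟶ A₂`, for a morphism `m : A₂ ⟶ A₁` with `d₀ m = μ · T d₀ · d₁`. -/
def TGraph.m₂ (A : TGraph T) (m : A.pairs ⟶ A.mor)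
    (hdom : m ≫ A.dom = A.d₁ ≫ T.map A.dom ≫ T.μ.app A.ob) : A.triples ⟶ A.pairs :=
  pullback.lift (A.d₂ ≫ T.map A.d₁ ≫ T.μ.app A.mor) (A.c₂ ≫ m) (by
    have h₁ : T.map A.d₁ ≫ T.map (T.map A.cod) = T.map A.c₁ ≫ T.map A.dom := by
      rw [← T.map_comp, ← T.map_comp, pullback.condition]
    have h₂ : T.μ.app A.mor ≫ T.map A.cod = T.map (T.map A.cod) ≫ T.μ.app A.ob :=
      (T.μ.naturality A.cod).symm
    have h₃ : A.d₂ ≫ T.map A.c₁ = A.c₂ ≫ A.d₁ := pullback.condition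
    rw [Category.assoc, Category.assoc, Category.assoc, hdom, h₂, reassoc_of% h₁,
      reassoc_of% h₃])

/-- A `T`-category: a pointed `T`-graph with a composition `m : A₂ ⟶ A₁` satisfying the neutrality
and associativity laws. -/
structure TCat (T : CategoryTheory.Monad C) extends PointedTGraph T where
  /-- the composition morphism -/
  comp : toTGraph.pairs ⟶ mor
  comp_dom : comp ≫ dom = toTGraph.d₁ ≫ T.map dom ≫ T.μ.app ob
  comp_cod : comp ≫ cod = toTGraph.c₁ ≫ cod
  i₁_comp : toPointedTGraph.i₁ ≫ comp = 𝟙 mor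
  i₂_comp : toPointedTGraph.i₂ ≫ comp = 𝟙 mor
  assoc : toTGraph.m₁ comp comp_cod ≫ comp = toTGraph.m₂ comp comp_dom ≫ comp

/-- A morphism of `T`-graphs. -/
@[ext]
structure TGraph.Hom (A B : TGraph T) where
  /-- the object part -/
  f₀ : A.ob ⟶ B.ob
  /-- the morphism part -/
  f₁ : A.mor ⟶ B.mor
  dom_comm : A.dom ≫ T.map f₀ = f₁ ≫ B.dom
  cod_comm : A.cod ≫ f₀ = f₁ ≫ B.cod

/-- `f₂ = T f₁ × f₁ : A₂ ⟶ B₂` -/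
def TGraph.Hom.f₂ {A B : TGraph T} (f : TGraph.Hom A B) : A.pairs ⟶ B.pairs :=
  pullback.lift (A.d₁ ≫ T.map f.f₁) (A.c₁ ≫ f.f₁) (by
    rw [Category.assoc, Category.assoc, ← T.map_comp, ← f.cod_comm, ← f.dom_comm, T.map_comp,
      ← Category.assoc, pullback.condition, Category.assoc])

theorem TGraph.Hom.f₂_d₁ {A B : TGraph T} (f : TGraph.Hom A B) :
    f.f₂ ≫ B.d₁ = A.d₁ ≫ T.map f.f₁ :=
  pullback.lift_fst _ _ _

theorem TGraph.Hom.f₂_c₁ {A B : TGraph T} (f : TGraph.Hom A B) :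
    f.f₂ ≫ B.c₁ = A.c₁ ≫ f.f₁ :=
  pullback.lift_snd _ _ _

namespace TCat

/-- A `T`-functor: a morphism of `T`-graphs preserving identities and composition. -/
@[ext]
structure Hom (A B : TCat T) extends TGraph.Hom A.toTGraph B.toTGraph where
  ins_comm : A.ins ≫ f₁ = f₀ ≫ B.ins
  comp_comm : A.comp ≫ f₁ = toHom.f₂ ≫ B.comp

/-- The category `Cat(T)` of `T`-categories and `T`-functors. -/
instance : Category (TCat T) where
  Hom A B := TCat.Hom A B
  id A :=
    { f₀ := 𝟙 A.ob
      f₁ := 𝟙 A.mor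
      dom_comm := by rw [T.map_id, Category.comp_id, Category.id_comp]
      cod_comm := by rw [Category.comp_id, Category.id_comp]
      ins_comm := by rw [Category.comp_id, Category.id_comp]
      comp_comm := by
        rw [Category.comp_id]
        have h : TGraph.Hom.f₂ (A := A.toTGraph) (B := A.toTGraph)
            ⟨𝟙 A.ob, 𝟙 A.mor, by rw [T.map_id, Category.comp_id, Category.id_comp],
              by rw [Category.comp_id, Category.id_comp]⟩ = 𝟙 A.pairs := by
          apply pullback.hom_ext <;> simp [TGraph.Hom.f₂]
        rw [h, Category.id_comp] }
  comp {A B D} f g :=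
    { f₀ := f.f₀ ≫ g.f₀
      f₁ := f.f₁ ≫ g.f₁
      dom_comm := by
        rw [T.map_comp, ← Category.assoc, f.dom_comm, Category.assoc, g.dom_comm, Category.assoc]
      cod_comm := by
        rw [← Category.assoc, f.cod_comm, Category.assoc, g.cod_comm, Category.assoc]
      ins_comm := by
        rw [← Category.assoc, f.ins_comm, Category.assoc, g.ins_comm, Category.assoc]
      comp_comm := by
        rw [← Category.assoc, f.comp_comm, Category.assoc, g.comp_comm, ← Category.assoc]
        congr 1
        apply pullback.hom_ext
        · rw [Category.assoc, TGraph.Hom.f₂_d₁, ← Category.assoc, TGraph.Hom.f₂_d₁,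
            TGraph.Hom.f₂_d₁, T.map_comp, Category.assoc]
        · rw [Category.assoc, TGraph.Hom.f₂_c₁, ← Category.assoc, TGraph.Hom.f₂_c₁,
            TGraph.Hom.f₂_c₁, Category.assoc] }
  id_comp f := TCat.Hom.ext (Category.id_comp _) (Category.id_comp _)
  comp_id f := TCat.Hom.ext (Category.comp_id _) (Category.comp_id _)
  assoc f g h := TCat.Hom.ext (Category.assoc _ _ _) (Category.assoc _ _ _)

variable (T) in
/-- A `T`-category is ordered if its span `(d₀, c₀)` is monic. -/
def IsOrdered : ObjectProperty (TCat T) := fun A =>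
  ∀ ⦃X : C⦄ (x y : X ⟶ A.mor), x ≫ A.dom = y ≫ A.dom → x ≫ A.cod = y ≫ A.cod → x = y

variable (T) in
/-- A `T`-functor `f` is perfect if the square formed by `d₀`, `f₁`, `T f₀`, `d₀` is a pullback. -/
def Perfect : MorphismProperty (TCat T) := fun A B f =>
  IsPullback A.dom f.f₁ (T.map f.f₀) B.dom

variable (T) in
/-- A `T`-functor is initial if it is left orthogonal, in `Cat(T)`, to all perfect `T`-functors. -/
def Initial : MorphismProperty (TCat T) := fun _ _ e =>
  ∀ ⦃D E : TCat T⦄ (n : D ⟶ E), Perfect T n → Orthogonal e n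

end TCat

variable (T) in
/-- The category `Ord(T)`, as a full subcategory of `Cat(T)`. -/
abbrev TOrd := (TCat.IsOrdered T).FullSubcategory

variable (T) in
/-- The inclusion of `Ord(T)` into `Cat(T)`. -/
abbrev TOrd.incl : TOrd T ⥤ TCat T := (TCat.IsOrdered T).ι

end

end Burroni

/-!
The order plays almost no role: every `T`-functor has a comprehensive factorization, and a perfect
`T`-functor with ordered codomain has ordered domain, because a morphism of its domain is determined
by its own domain together with its image (`isOrdered_of_perfect`).

For a `T`-category `B`, the assignment `Z ↦ T Z ×_{T B₀} B₁` is a monad on `C / B₀`; its unit and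
multiplication come from the identities and the composition of `B`, and `T` need not preserve
pullbacks for this. The monad is presented by `free`, `unit` and the Kleisli extension `bind`. An
algebra for it is the object of objects of a perfect `T`-functor to `B` (`ofAlgebra`). The monad
preserves coequalizers of reflexive pairs, because `T` does and these coequalizers are stable under
pullback (`IsReflexiveCoequalizer.freeMap`); hence a reflexive coequalizer of free algebras is an
algebra (`exists_algebra`).

Given `f : A ⟶ B`, let `P₀` be the coequalizer of the two algebra morphisms from the free algebra on
`A₁` to the free algebra on `A₀` which are induced by the codomain and by the pair `(d₀, f₁)`. For
the identity monad on sets this is the family of sets of components of the comma categories `f / b`.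
The resulting perfect `T`-functor `P ⟶ B` is the second factor. The first factor is initial
(`initial_of_coequalizer`): in a square from it to a perfect `n : D ⟶ E`, the morphisms of `E` that
come from `T A₀ ×_{T B₀} B₁` lift uniquely along `n`, and the codomains of the lifts give a morphism
to `D₀` which factors through the coequalizer.

In a pullback of `T`-categories, the domain of a morphism has to be given separately, as an element
of `T` applied to the pullback of the objects of objects (`pbMor`); the laws are then checked
componentwise (`pb_hom_ext`). Ordered `T`-categories are closed under these pullbacks because the
components of a morphism are determined by their domains and codomains (`isOrdered_pb`).
-/

namespace Burroni

variable {C : Type u} [Category.{v} C]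

section Monad

variable (T : CategoryTheory.Monad C)

theorem map_map_μ {X Y : C} (f : X ⟶ Y) :
    T.map (T.map f) ≫ T.μ.app Y = T.μ.app X ≫ T.map f :=
  T.μ.naturality f

theorem comp_η {X Y : C} (f : X ⟶ Y) : f ≫ T.η.app Y = T.η.app X ≫ T.map f :=
  T.η.naturality f

end Monad

variable [HasPullbacks C] {T : CategoryTheory.Monad C}

attribute [local simp] pullback.lift_fst pullback.lift_snd pullback.lift_fst_assoc
  pullback.lift_snd_assoc

/-! ### Transport of the laws of a `T`-category along morphisms of `T`-graphs -/

section Laws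

variable (Q : PointedTGraph T) (m : Q.pairs ⟶ Q.mor)

theorem PointedTGraph.i₁_comp_dom (hd : m ≫ Q.dom = Q.d₁ ≫ T.map Q.dom ≫ T.μ.app Q.ob) :
    (Q.i₁ ≫ m) ≫ Q.dom = Q.dom := by
  rw [Category.assoc, hd, PointedTGraph.i₁, pullback.lift_fst_assoc, Category.assoc,
    ← T.map_comp_assoc, Q.ins_dom, T.right_unit]
  exact Category.comp_id _

theorem PointedTGraph.i₂_comp_dom (hd : m ≫ Q.dom = Q.d₁ ≫ T.map Q.dom ≫ T.μ.app Q.ob) :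
    (Q.i₂ ≫ m) ≫ Q.dom = Q.dom := by
  rw [Category.assoc, hd, PointedTGraph.i₂, pullback.lift_fst_assoc, ← reassoc_of% @comp_η,
    T.left_unit]
  exact Category.comp_id _

theorem TGraph.m₁_comp_dom {Q : TGraph T} {m : Q.pairs ⟶ Q.mor}
    (hd : m ≫ Q.dom = Q.d₁ ≫ T.map Q.dom ≫ T.μ.app Q.ob) (hc : m ≫ Q.cod = Q.c₁ ≫ Q.cod) :
    (Q.m₁ m hc ≫ m) ≫ Q.dom = (Q.m₂ m hd ≫ m) ≫ Q.dom := by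
  rw [Category.assoc, Category.assoc, hd, TGraph.m₁, TGraph.m₂, pullback.lift_fst_assoc,
    pullback.lift_fst_assoc, Category.assoc, ← T.map_comp_assoc, hd]
  simp only [T.map_comp, Category.assoc, T.assoc]
  rw [reassoc_of% @map_map_μ]

variable {Q m} {A : TCat T} (f : TGraph.Hom Q.toTGraph A.toTGraph)
  (hi : Q.ins ≫ f.f₁ = f.f₀ ≫ A.ins) (hm : m ≫ f.f₁ = f.f₂ ≫ A.comp)

include hi hm in
/-- A morphism of pointed `T`-graphs to a `T`-category that preserves the composition carries the
first neutrality law. If such morphisms and the domain are jointly monic, the law therefore holds in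
the source; the same applies to the other two laws. -/
theorem PointedTGraph.i₁_comp_map : (Q.i₁ ≫ m) ≫ f.f₁ = f.f₁ := by
  have : Q.i₁ ≫ f.f₂ = f.f₁ ≫ A.i₁ := by
    apply pullback.hom_ext
    · simp only [Category.assoc, f.f₂_d₁, PointedTGraph.i₁, pullback.lift_fst_assoc,
        pullback.lift_fst]
      rw [← T.map_comp, hi, T.map_comp, reassoc_of% f.dom_comm]
    · simp only [Category.assoc, f.f₂_c₁, PointedTGraph.i₁, pullback.lift_snd_assoc,
        pullback.lift_snd, Category.comp_id, Category.id_comp]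
  rw [Category.assoc, hm, reassoc_of% this, A.i₁_comp, Category.comp_id]

include hi hm in
theorem PointedTGraph.i₂_comp_map : (Q.i₂ ≫ m) ≫ f.f₁ = f.f₁ := by
  have : Q.i₂ ≫ f.f₂ = f.f₁ ≫ A.i₂ := by
    apply pullback.hom_ext
    · simp only [Category.assoc, f.f₂_d₁, PointedTGraph.i₂, pullback.lift_fst_assoc,
        pullback.lift_fst]
      rw [comp_η]
    · simp only [Category.assoc, f.f₂_c₁, PointedTGraph.i₂, pullback.lift_snd_assoc,
        pullback.lift_snd, hi, reassoc_of% f.cod_comm]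
  rw [Category.assoc, hm, reassoc_of% this, A.i₂_comp, Category.comp_id]

include hm in
theorem TGraph.m₁_comp_map (hd : m ≫ Q.dom = Q.d₁ ≫ T.map Q.dom ≫ T.μ.app Q.ob)
    (hc : m ≫ Q.cod = Q.c₁ ≫ Q.cod) :
    (Q.m₁ m hc ≫ m) ≫ f.f₁ = (Q.m₂ m hd ≫ m) ≫ f.f₁ := by
  have h₃ : (Q.d₂ ≫ T.map f.f₂) ≫ T.map A.c₁ = (Q.c₂ ≫ f.f₂) ≫ A.d₁ := by
    simp only [Category.assoc, f.f₂_d₁, ← T.map_comp, f.f₂_c₁]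
    simp only [T.map_comp]
    rw [pullback.condition_assoc]
  let f₃ : Q.triples ⟶ A.triples := pullback.lift (Q.d₂ ≫ T.map f.f₂) (Q.c₂ ≫ f.f₂) h₃
  have e₁ : Q.m₁ m hc ≫ f.f₂ = f₃ ≫ A.m₁ A.comp A.comp_cod := by
    apply pullback.hom_ext
    · simp only [Category.assoc, f.f₂_d₁, TGraph.m₁, pullback.lift_fst_assoc,
        pullback.lift_fst, f₃, ← T.map_comp, hm]
    · simp only [Category.assoc, f.f₂_c₁, TGraph.m₁, pullback.lift_snd_assoc,
        pullback.lift_snd, f₃]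
  have e₂ : Q.m₂ m hd ≫ f.f₂ = f₃ ≫ A.m₂ A.comp A.comp_dom := by
    apply pullback.hom_ext
    · simp only [Category.assoc, f.f₂_d₁, TGraph.m₂, pullback.lift_fst_assoc,
        pullback.lift_fst, f₃]
      rw [← T.map_comp_assoc, f.f₂_d₁, T.map_comp_assoc, map_map_μ]
    · simp only [Category.assoc, f.f₂_c₁, TGraph.m₂, pullback.lift_snd_assoc,
        pullback.lift_snd, f₃, hm]
  rw [Category.assoc, Category.assoc, hm, reassoc_of% e₁, reassoc_of% e₂, A.assoc]

end Laws

namespace TCat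

@[simp] theorem comp_f₀ {A B D : TCat T} (f : A ⟶ B) (g : B ⟶ D) :
  (f ≫ g).f₀ = f.f₀ ≫ g.f₀ := rfl
@[simp] theorem comp_f₁ {A B D : TCat T} (f : A ⟶ B) (g : B ⟶ D) :
  (f ≫ g).f₁ = f.f₁ ≫ g.f₁ := rfl

theorem hom_ext {A B : TCat T} {f g : A ⟶ B} (h₀ : f.f₀ = g.f₀) (h₁ : f.f₁ = g.f₁) : f = g :=
  TCat.Hom.ext h₀ h₁

/-! ### Composition of generalized elements -/

section Mul

variable (B : TCat T) {Z : C}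

/-- The composite, in the `T`-category `B`, of a generalized composable pair: a family `x` of
morphisms followed by a morphism `y`. -/
noncomputable def mul (x : Z ⟶ T.obj B.mor) (y : Z ⟶ B.mor) (h : x ≫ T.map B.cod = y ≫ B.dom) :
    Z ⟶ B.mor :=
  pullback.lift x y h ≫ B.comp

variable {B} {x : Z ⟶ T.obj B.mor} {y : Z ⟶ B.mor} (h : x ≫ T.map B.cod = y ≫ B.dom)

theorem mul_dom : B.mul x y h ≫ B.dom = x ≫ T.map B.dom ≫ T.μ.app B.ob := by
  rw [mul, Category.assoc, B.comp_dom, pullback.lift_fst_assoc]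

theorem mul_cod : B.mul x y h ≫ B.cod = y ≫ B.cod := by
  rw [mul, Category.assoc, B.comp_cod, pullback.lift_snd_assoc]

theorem comp_mul {W : C} (u : W ⟶ Z) :
    u ≫ B.mul x y h = B.mul (u ≫ x) (u ≫ y) (by simp only [Category.assoc, h]) := by
  rw [mul, mul, ← Category.assoc]
  congr 1
  apply pullback.hom_ext <;> simp

theorem mul_map {D : TCat T} (f : B ⟶ D) :
    B.mul x y h ≫ f.f₁ = D.mul (x ≫ T.map f.f₁) (y ≫ f.f₁) (by
      rw [Category.assoc, Category.assoc, ← T.map_comp, ← f.cod_comm, ← f.dom_comm, T.map_comp,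
        reassoc_of% h]) := by
  rw [mul, mul, Category.assoc, f.comp_comm, ← Category.assoc]
  congr 1
  apply pullback.hom_ext <;>
    simp [f.f₂_d₁, f.f₂_c₁]

theorem ins_mul (y : Z ⟶ B.mor) :
    B.mul (y ≫ B.dom ≫ T.map B.ins) y
      (by simp only [Category.assoc, ← T.map_comp, B.ins_cod, T.map_id, Category.comp_id]) = y := by
  have : pullback.lift (y ≫ B.dom ≫ T.map B.ins) y
      (by simp only [Category.assoc, ← T.map_comp, B.ins_cod, T.map_id, Category.comp_id])
      = y ≫ B.i₁ := by
    apply pullback.hom_ext <;> simp [PointedTGraph.i₁]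
  rw [mul, this, Category.assoc, B.i₁_comp, Category.comp_id]

theorem mul_ins (y : Z ⟶ B.mor) :
    B.mul (y ≫ T.η.app _) (y ≫ B.cod ≫ B.ins)
      (by rw [Category.assoc, Category.assoc, Category.assoc, B.ins_dom, ← comp_η]) = y := by
  have : pullback.lift (y ≫ T.η.app _) (y ≫ B.cod ≫ B.ins)
      (by rw [Category.assoc, Category.assoc, Category.assoc, B.ins_dom, ← comp_η])
      = y ≫ B.i₂ := by
    apply pullback.hom_ext <;> simp [PointedTGraph.i₂]
  rw [mul, this, Category.assoc, B.i₂_comp, Category.comp_id]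

theorem mul_congr {x x' : Z ⟶ T.obj B.mor} {y y' : Z ⟶ B.mor} (hx : x = x') (hy : y = y')
    (h : x ≫ T.map B.cod = y ≫ B.dom) :
    B.mul x y h = B.mul x' y' (by rw [← hx, ← hy, h]) := by
  subst hx hy; rfl

/-- Associativity of the composition, for generalized elements. -/
theorem mul_mul {W : C} (x : Z ⟶ T.obj W) {u : W ⟶ T.obj B.mor} {v : W ⟶ B.mor}
    (huv : u ≫ T.map B.cod = v ≫ B.dom) (y : Z ⟶ B.mor)
    (h : (x ≫ T.map v) ≫ T.map B.cod = y ≫ B.dom) :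
    B.mul (x ≫ T.map (B.mul u v huv)) y
      (by rw [Category.assoc, ← T.map_comp, mul_cod, T.map_comp, ← Category.assoc, h]) =
    B.mul (x ≫ T.map u ≫ T.μ.app _) (B.mul (x ≫ T.map v) y h) (by
      rw [mul_dom, Category.assoc, Category.assoc, ← map_map_μ, ← T.map_comp_assoc, huv,
        T.map_comp_assoc, Category.assoc]) := by
  let t : Z ⟶ B.triples := pullback.lift (x ≫ T.map (pullback.lift u v huv))
    (pullback.lift (x ≫ T.map v) y h) (by
      rw [Category.assoc, ← T.map_comp, pullback.lift_snd, pullback.lift_fst])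
  have h₁ : B.mul (x ≫ T.map (B.mul u v huv)) y
      (by rw [Category.assoc, ← T.map_comp, mul_cod, T.map_comp, ← Category.assoc, h]) =
      t ≫ B.m₁ B.comp B.comp_cod ≫ B.comp := by
    refine (congrArg (· ≫ B.comp) ?_).trans (Category.assoc _ _ _)
    apply pullback.hom_ext <;> simp [TGraph.m₁, t, mul]
  rw [h₁, B.assoc, ← Category.assoc]
  refine congrArg (· ≫ B.comp) ?_
  apply pullback.hom_ext
  · simp only [Category.assoc, TGraph.m₂, pullback.lift_fst, t, pullback.lift_fst_assoc]
    rw [← T.map_comp_assoc, pullback.lift_fst]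
  · simp [TGraph.m₂, t, mul]

end Mul

/-! ### The monad on `C / B₀` induced by a `T`-category `B` -/

noncomputable section Kleisli

variable (B : TCat T)

/-- The object `T Z ×_{T B₀} B₁` over `B₀`, for `Z` over `B₀`: a family of elements of `Z`
followed by a morphism of `B` out of the underlying family of objects. It is the value at `Z` of
the monad on `C / B₀` induced by `B`. -/
def free (Z : Over B.ob) : Over B.ob :=
  Over.mk (pullback.snd (T.map Z.hom) B.dom ≫ B.cod)

/-- The projection of `free B Z` to `T Z`. -/
def freeFst (Z : Over B.ob) : (B.free Z).left ⟶ T.obj Z.left :=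
  pullback.fst (T.map Z.hom) B.dom

/-- The projection of `free B Z` to `B₁`. -/
def freeSnd (Z : Over B.ob) : (B.free Z).left ⟶ B.mor :=
  pullback.snd (T.map Z.hom) B.dom

variable {B} {Z W V : Over B.ob}

theorem free_isPullback (Z : Over B.ob) :
    IsPullback (B.freeFst Z) (B.freeSnd Z) (T.map Z.hom) B.dom :=
  IsPullback.of_hasPullback _ _

theorem freeFst_map_hom : B.freeFst Z ≫ T.map Z.hom = B.freeSnd Z ≫ B.dom :=
  (free_isPullback Z).w

@[simp]
theorem freeSnd_cod : B.freeSnd Z ≫ B.cod = (B.free Z).hom := rfl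

theorem free_hom_ext {X : C} {x y : X ⟶ (B.free Z).left}
    (h₁ : x ≫ B.freeFst Z = y ≫ B.freeFst Z) (h₂ : x ≫ B.freeSnd Z = y ≫ B.freeSnd Z) : x = y :=
  (free_isPullback Z).hom_ext h₁ h₂

/-- The morphism `X ⟶ free B Z` with given components. -/
def freeLift {X : C} (x : X ⟶ T.obj Z.left) (y : X ⟶ B.mor)
    (h : x ≫ T.map Z.hom = y ≫ B.dom) : X ⟶ (B.free Z).left :=
  (free_isPullback Z).lift x y h

@[simp]
theorem freeLift_freeFst {X : C} (x : X ⟶ T.obj Z.left) (y : X ⟶ B.mor)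
    (h : x ≫ T.map Z.hom = y ≫ B.dom) : freeLift x y h ≫ B.freeFst Z = x :=
  (free_isPullback Z).lift_fst _ _ _

@[simp]
theorem freeLift_freeSnd {X : C} (x : X ⟶ T.obj Z.left) (y : X ⟶ B.mor)
    (h : x ≫ T.map Z.hom = y ≫ B.dom) : freeLift x y h ≫ B.freeSnd Z = y :=
  (free_isPullback Z).lift_snd _ _ _

/-- The unit `(η, i)` of the monad `free B`. -/
def unit (Z : Over B.ob) : Z ⟶ B.free Z :=
  Over.homMk (freeLift (T.η.app Z.left) (Z.hom ≫ B.ins) (by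
    rw [Category.assoc, B.ins_dom, comp_η])) (by
    rw [← freeSnd_cod, reassoc_of% @freeLift_freeSnd, Category.assoc, B.ins_cod, Category.comp_id])

@[simp]
theorem unit_freeFst : (unit Z).left ≫ B.freeFst Z = T.η.app Z.left :=
  freeLift_freeFst _ _ _

@[simp]
theorem unit_freeSnd : (unit Z).left ≫ B.freeSnd Z = Z.hom ≫ B.ins :=
  freeLift_freeSnd _ _ _

theorem bind_aux (h : Z ⟶ B.free W) :
    (B.freeFst Z ≫ T.map (h.left ≫ B.freeSnd W)) ≫ T.map B.cod = B.freeSnd Z ≫ B.dom := by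
  rw [Category.assoc, ← T.map_comp, Category.assoc, freeSnd_cod, Over.w h, freeFst_map_hom]

/-- The Kleisli extension of `h : Z ⟶ free B W` for the monad `free B`. -/
def bind (h : Z ⟶ B.free W) : B.free Z ⟶ B.free W :=
  Over.homMk (freeLift (B.freeFst Z ≫ T.map (h.left ≫ B.freeFst W) ≫ T.μ.app _)
    (B.mul (B.freeFst Z ≫ T.map (h.left ≫ B.freeSnd W)) (B.freeSnd Z) (bind_aux h)) (by
      rw [mul_dom, Category.assoc, Category.assoc, Category.assoc, ← map_map_μ,
        ← T.map_comp_assoc, ← T.map_comp_assoc, Category.assoc, Category.assoc,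
        freeFst_map_hom])) (by
    rw [← freeSnd_cod, reassoc_of% @freeLift_freeSnd, mul_cod, freeSnd_cod])

@[simp]
theorem bind_freeFst (h : Z ⟶ B.free W) : (bind h).left ≫ B.freeFst W =
    B.freeFst Z ≫ T.map (h.left ≫ B.freeFst W) ≫ T.μ.app _ :=
  freeLift_freeFst _ _ _

@[simp]
theorem bind_freeSnd (h : Z ⟶ B.free W) : (bind h).left ≫ B.freeSnd W =
    B.mul (B.freeFst Z ≫ T.map (h.left ≫ B.freeSnd W)) (B.freeSnd Z) (bind_aux h) :=
  freeLift_freeSnd _ _ _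

@[simp]
theorem bind_unit : bind (unit Z) = 𝟙 (B.free Z) := by
  ext
  apply free_hom_ext
  · rw [bind_freeFst, unit_freeFst, T.right_unit, Over.id_left, Category.id_comp]
    exact Category.comp_id _
  · rw [bind_freeSnd, Over.id_left, Category.id_comp]
    refine (mul_congr ?_ rfl _).trans (ins_mul (B.freeSnd Z))
    rw [unit_freeSnd, T.map_comp, reassoc_of% @freeFst_map_hom]

@[simp]
theorem unit_bind (h : Z ⟶ B.free W) : unit Z ≫ bind h = h := by
  ext
  apply free_hom_ext
  · rw [Over.comp_left, Category.assoc, bind_freeFst, reassoc_of% @unit_freeFst,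
      ← reassoc_of% @comp_η,
      T.left_unit]
    exact Category.comp_id _
  · rw [Over.comp_left, Category.assoc, bind_freeSnd, comp_mul]
    refine (mul_congr ?_ ?_ _).trans (mul_ins (h.left ≫ B.freeSnd W))
    · rw [reassoc_of% @unit_freeFst, comp_η]
    · rw [unit_freeSnd, Category.assoc, reassoc_of% @freeSnd_cod, Over.w_assoc h]

theorem bind_bind (h : Z ⟶ B.free W) (k : W ⟶ B.free V) :
    bind h ≫ bind k = bind (h ≫ bind k) := by
  ext
  apply free_hom_ext
  · simp only [Over.comp_left, Category.assoc, bind_freeFst, reassoc_of% @bind_freeFst, T.map_comp,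
      T.assoc]
    rw [reassoc_of% @map_map_μ, reassoc_of% @map_map_μ]
  · rw [Over.comp_left, Category.assoc, bind_freeSnd, bind_freeSnd, comp_mul]
    have e : (h ≫ bind k).left ≫ B.freeSnd V = B.mul
        (h.left ≫ B.freeFst W ≫ T.map (k.left ≫ B.freeSnd V)) (h.left ≫ B.freeSnd W)
        (by simp only [Category.assoc]; rw [← bind_aux k, Category.assoc]) := by
      rw [Over.comp_left, Category.assoc, bind_freeSnd, comp_mul]
    have := mul_mul (B.freeFst Z) (u := h.left ≫ B.freeFst W ≫ T.map (k.left ≫ B.freeSnd V))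
      (v := h.left ≫ B.freeSnd W)
      (by simp only [Category.assoc]; rw [← bind_aux k, Category.assoc]) (B.freeSnd Z) (bind_aux h)
    refine Eq.trans (mul_congr ?_ (bind_freeSnd h) _) (this.symm.trans (mul_congr ?_ rfl _))
    · rw [reassoc_of% @bind_freeFst]
      simp only [T.map_comp, Category.assoc]
      rw [map_map_μ, reassoc_of% @map_map_μ]
    · rw [e]

/-- The action of the monad `free B` on morphisms. -/
def freeMap (h : Z ⟶ W) : B.free Z ⟶ B.free W := bind (h ≫ unit W)

@[simp]
theorem freeMap_freeFst (h : Z ⟶ W) :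
    (freeMap h).left ≫ B.freeFst W = B.freeFst Z ≫ T.map h.left := by
  rw [freeMap, bind_freeFst, Over.comp_left, Category.assoc, unit_freeFst, T.map_comp_assoc,
    T.right_unit]
  exact congrArg _ (Category.comp_id _)

@[simp]
theorem freeMap_freeSnd (h : Z ⟶ W) : (freeMap h).left ≫ B.freeSnd W = B.freeSnd Z := by
  rw [freeMap, bind_freeSnd]
  refine (mul_congr ?_ rfl _).trans (ins_mul (B.freeSnd Z))
  rw [Over.comp_left, Category.assoc, unit_freeSnd, Over.w_assoc h, T.map_comp,
    reassoc_of% @freeFst_map_hom]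

theorem freeMap_isPullback (h : Z ⟶ W) :
    IsPullback (B.freeFst Z) (freeMap h).left (T.map h.left) (B.freeFst W) := by
  have := free_isPullback Z
  rw [← freeMap_freeSnd h, ← Over.w h, T.map_comp] at this
  exact IsPullback.of_right (this.flip) (freeMap_freeFst h) (free_isPullback W).flip |>.flip

theorem freeMap_comp (h : Z ⟶ W) (k : W ⟶ V) :
    freeMap (h ≫ k) = (freeMap h ≫ freeMap k : B.free Z ⟶ B.free V) := by
  simp [freeMap, bind_bind]

theorem freeMap_bind (h : Z ⟶ W) (k : W ⟶ B.free V) :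
    freeMap h ≫ bind k = bind (h ≫ k) := by
  simp [freeMap, bind_bind]

end Kleisli

/-! ### Perfect `T`-functors as algebras -/

noncomputable section Perfect

/-- A graph morphism into the domain of a perfect `T`-functor is a `T`-functor as soon as its
composite with the perfect `T`-functor is one. -/
def homOfPerfect {A D E : TCat T} {n : D ⟶ E} (hn : Perfect T n)
    (w : TGraph.Hom A.toTGraph D.toTGraph) (b : A ⟶ E) (h₀ : w.f₀ ≫ n.f₀ = b.f₀)
    (h₁ : w.f₁ ≫ n.f₁ = b.f₁) : A ⟶ D :=
  { w with
    ins_comm := by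
      apply IsPullback.hom_ext hn
      · rw [Category.assoc, ← w.dom_comm, Category.assoc, D.ins_dom, reassoc_of% A.ins_dom, comp_η]
      · rw [Category.assoc, h₁, b.ins_comm, Category.assoc, n.ins_comm, ← h₀, Category.assoc]
    comp_comm := by
      apply IsPullback.hom_ext hn
      · rw [Category.assoc, ← w.dom_comm, Category.assoc, D.comp_dom, reassoc_of% A.comp_dom,
          reassoc_of% w.f₂_d₁, ← map_map_μ, ← T.map_comp_assoc, ← T.map_comp_assoc, w.dom_comm]
      · rw [Category.assoc, h₁, b.comp_comm, Category.assoc, n.comp_comm, ← Category.assoc]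
        congr 1
        apply pullback.hom_ext
        · rw [b.f₂_d₁, Category.assoc, n.f₂_d₁, reassoc_of% w.f₂_d₁, ← T.map_comp, h₁]
        · rw [b.f₂_c₁, Category.assoc, n.f₂_c₁, reassoc_of% w.f₂_c₁, h₁] }

theorem isOrdered_of_perfect {P B : TCat T} {p : P ⟶ B} (hp : Perfect T p)
    (hB : IsOrdered T B) : IsOrdered T P := by
  intro X x y hd hc
  refine IsPullback.hom_ext hp hd (hB _ _ ?_ ?_)
  · rw [Category.assoc, Category.assoc, ← p.dom_comm, reassoc_of% hd]
  · rw [Category.assoc, Category.assoc, ← p.cod_comm, reassoc_of% hc]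

end Perfect

noncomputable section Algebra

variable {B : TCat T} {P : Over B.ob} (a : B.free P ⟶ P)

/-- The pointed `T`-graph underlying the `T`-category of an algebra for `free B`. -/
abbrev algebraGraph (hη : unit P ≫ a = 𝟙 P) : PointedTGraph T where
  ob := P.left
  mor := (B.free P).left
  dom := B.freeFst P
  cod := a.left
  ins := (unit P).left
  ins_dom := unit_freeFst
  ins_cod := by rw [← Over.comp_left, hη, Over.id_left]

/-- The projection to `B` of the pointed `T`-graph of an algebra for `free B`. -/
abbrev algebraGraphProj (hη : unit P ≫ a = 𝟙 P) :
    TGraph.Hom (algebraGraph a hη).toTGraph B.toTGraph where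
  f₀ := P.hom
  f₁ := B.freeSnd P
  dom_comm := freeFst_map_hom
  cod_comm := (Over.w a)

/-- The composition of the `T`-category of an algebra for `free B`. -/
def algebraComp (hη : unit P ≫ a = 𝟙 P) :
    (algebraGraph a hη).pairs ⟶ (algebraGraph a hη).mor :=
  freeLift ((algebraGraph a hη).d₁ ≫ T.map (B.freeFst P) ≫ T.μ.app _)
    ((algebraGraphProj a hη).f₂ ≫ B.comp) (by
      rw [Category.assoc, Category.assoc, ← map_map_μ, ← T.map_comp_assoc, freeFst_map_hom,
        Category.assoc, B.comp_dom, reassoc_of% @TGraph.Hom.f₂_d₁, T.map_comp_assoc])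

theorem algebraComp_fst (hη : unit P ≫ a = 𝟙 P) :
    algebraComp a hη ≫ B.freeFst P =
      (algebraGraph a hη).d₁ ≫ T.map (B.freeFst P) ≫ T.μ.app _ :=
  freeLift_freeFst _ _ _

theorem algebraComp_snd (hη : unit P ≫ a = 𝟙 P) :
    algebraComp a hη ≫ B.freeSnd P = (algebraGraphProj a hη).f₂ ≫ B.comp :=
  freeLift_freeSnd _ _ _

theorem algebraComp_cod (hη : unit P ≫ a = 𝟙 P)
    (hμ : bind (𝟙 (B.free P)) ≫ a = freeMap a ≫ a) :
    algebraComp a hη ≫ a.left = (algebraGraph a hη).c₁ ≫ a.left := by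
  let k : (algebraGraph a hη).pairs ⟶ (B.free (B.free P)).left :=
    freeLift (Z := B.free P) (algebraGraph a hη).d₁ ((algebraGraph a hη).c₁ ≫ B.freeSnd P) (by
      rw [← Over.w a, T.map_comp, Category.assoc, ← freeFst_map_hom]
      exact pullback.condition_assoc _)
  have h₁ : k ≫ (bind (𝟙 (B.free P))).left = algebraComp a hη := by
    apply free_hom_ext
    · rw [Category.assoc, bind_freeFst, Over.id_left, Category.id_comp,
        reassoc_of% @freeLift_freeFst,
        algebraComp_fst]
    · rw [Category.assoc, bind_freeSnd, comp_mul, algebraComp_snd, mul]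
      congr 1
      apply pullback.hom_ext
      · rw [pullback.lift_fst, Over.id_left, Category.id_comp,
        reassoc_of% @freeLift_freeFst,
          TGraph.Hom.f₂_d₁]
      · rw [pullback.lift_snd, freeLift_freeSnd, TGraph.Hom.f₂_c₁]
  have h₂ : k ≫ (freeMap a).left = (algebraGraph a hη).c₁ := by
    apply free_hom_ext
    · rw [Category.assoc, freeMap_freeFst, reassoc_of% @freeLift_freeFst]
      exact pullback.condition
    · rw [Category.assoc, freeMap_freeSnd, freeLift_freeSnd]
  rw [← h₁, Category.assoc, ← Over.comp_left, hμ, Over.comp_left, reassoc_of% h₂]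

/-- The `T`-category with object of objects `P` of an algebra `a : free B P ⟶ P`. Its projection
to `B` is perfect by `perfect_ofAlgebraProj`. -/
def ofAlgebra (hη : unit P ≫ a = 𝟙 P) (hμ : bind (𝟙 (B.free P)) ≫ a = freeMap a ≫ a) :
    TCat T where
  toPointedTGraph := algebraGraph a hη
  comp := algebraComp a hη
  comp_dom := algebraComp_fst a hη
  comp_cod := algebraComp_cod a hη hμ
  i₁_comp := by
    apply free_hom_ext
    · exact (PointedTGraph.i₁_comp_dom _ _ (algebraComp_fst a hη)).trans (Category.id_comp _).symm
    · exact (PointedTGraph.i₁_comp_map (algebraGraphProj a hη) unit_freeSnd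
        (algebraComp_snd a hη)).trans (Category.id_comp _).symm
  i₂_comp := by
    apply free_hom_ext
    · exact (PointedTGraph.i₂_comp_dom _ _ (algebraComp_fst a hη)).trans (Category.id_comp _).symm
    · exact (PointedTGraph.i₂_comp_map (algebraGraphProj a hη) unit_freeSnd
        (algebraComp_snd a hη)).trans (Category.id_comp _).symm
  assoc := by
    apply free_hom_ext
    · exact TGraph.m₁_comp_dom _ _
    · exact TGraph.m₁_comp_map (algebraGraphProj a hη) (algebraComp_snd a hη) _ _

/-- The projection to `B` of the `T`-category of an algebra for `free B`. -/
def ofAlgebraProj (hη : unit P ≫ a = 𝟙 P) (hμ : bind (𝟙 (B.free P)) ≫ a = freeMap a ≫ a) :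
    ofAlgebra a hη hμ ⟶ B :=
  { algebraGraphProj a hη with
    ins_comm := unit_freeSnd
    comp_comm := algebraComp_snd a hη }

theorem perfect_ofAlgebraProj (hη : unit P ≫ a = 𝟙 P)
    (hμ : bind (𝟙 (B.free P)) ≫ a = freeMap a ≫ a) : Perfect T (ofAlgebraProj a hη hμ) :=
  free_isPullback P

end Algebra

section Coequalizer

variable {B : TCat T}

/-- The morphism `z` over `B₀` is, in `C`, a coequalizer of `s` and `t`, and these have a common
section over `B₀`. -/
structure IsReflexiveCoequalizer {Y X P : Over B.ob} (s t : Y ⟶ X) (z : X ⟶ P) : Prop where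
  exists_section : ∃ r : X ⟶ Y, r ≫ s = 𝟙 X ∧ r ≫ t = 𝟙 X
  w : s.left ≫ z.left = t.left ≫ z.left
  isColimit : Nonempty (IsColimit (Cofork.ofπ z.left w))

namespace IsReflexiveCoequalizer

variable {Y X P : Over B.ob} {s t : Y ⟶ X} {z : X ⟶ P}

theorem condition (h : IsReflexiveCoequalizer s t z) : s ≫ z = t ≫ z := by
  ext; exact h.w

theorem isReflexivePair (h : IsReflexiveCoequalizer s t z) : IsReflexivePair s.left t.left := by
  obtain ⟨r, h₁, h₂⟩ := h.exists_section
  exact ⟨r.left, by rw [← Over.comp_left, h₁, Over.id_left],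
    by rw [← Over.comp_left, h₂, Over.id_left]⟩

theorem epi_left (h : IsReflexiveCoequalizer s t z) : Epi z.left :=
  Cofork.IsColimit.epi h.isColimit.some

theorem epi (h : IsReflexiveCoequalizer s t z) : Epi z :=
  have := h.epi_left
  Over.epi_of_epi_left z

theorem exists_desc (h : IsReflexiveCoequalizer s t z) {Q : C} (k : X.left ⟶ Q)
    (hk : s.left ≫ k = t.left ≫ k) : ∃ l : P.left ⟶ Q, z.left ≫ l = k :=
  ⟨Cofork.IsColimit.desc h.isColimit.some k hk, Cofork.IsColimit.π_desc' h.isColimit.some k hk⟩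

theorem exists_overDesc (h : IsReflexiveCoequalizer s t z) {Q : Over B.ob} (k : X ⟶ Q)
    (hk : s ≫ k = t ≫ k) : ∃ l : P ⟶ Q, z ≫ l = k := by
  obtain ⟨l, hl⟩ := h.exists_desc k.left (by rw [← Over.comp_left, hk, Over.comp_left])
  have := h.epi_left
  refine ⟨Over.homMk l ?_, by ext; exact hl⟩
  rw [← cancel_epi z.left, reassoc_of% hl, Over.w k, Over.w z]

/-- The monad `free B` preserves reflexive coequalizers: `T` does, and `free B` is `T` followed by
a pullback. -/
theorem freeMap (hstable : ReflexiveCoequalizersPullbackStable C)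
    (hT : ∀ ⦃X Y : C⦄ (f g : X ⟶ Y) [IsReflexivePair f g],
      PreservesColimit (parallelPair f g) T.toFunctor)
    (h : IsReflexiveCoequalizer s t z) :
    IsReflexiveCoequalizer (B := B) (TCat.freeMap s) (TCat.freeMap t) (TCat.freeMap z) where
  exists_section := by
    obtain ⟨r, h₁, h₂⟩ := h.exists_section
    refine ⟨TCat.freeMap r, ?_, ?_⟩
    · rw [← freeMap_comp, h₁, TCat.freeMap, Category.id_comp, bind_unit]
    · rw [← freeMap_comp, h₂, TCat.freeMap, Category.id_comp, bind_unit]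
  w := by rw [← Over.comp_left, ← Over.comp_left, ← freeMap_comp, ← freeMap_comp, h.condition]
  isColimit := by
    have := h.isReflexivePair
    have := hT s.left t.left
    obtain ⟨r, h₁, h₂⟩ := h.isReflexivePair
    have : IsReflexivePair (T.map s.left) (T.map t.left) :=
      ⟨T.map r, by rw [← T.map_comp, h₁, T.map_id], by rw [← T.map_comp, h₂, T.map_id]⟩
    refine hstable (T.map s.left) (T.map t.left) (T.map z.left)
      (by rw [← T.map_comp, h.w, T.map_comp])
      ⟨isColimitCoforkMapOfIsColimit T.toFunctor h.w h.isColimit.some⟩ (B.freeFst P)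
      (B.freeFst X) _ (freeMap_isPullback z) (B.freeFst Y) (TCat.freeMap (s ≫ z)).left ?_
      _ _ (freeMap_freeFst s) ?_ (freeMap_freeFst t) ?_ _
    · have := freeMap_isPullback (B := B) (s ≫ z)
      rwa [Over.comp_left, T.map_comp] at this
    · rw [freeMap_comp, Over.comp_left]
    · rw [h.condition, freeMap_comp, Over.comp_left]

end IsReflexiveCoequalizer

/-- A reflexive coequalizer of free algebras carries an algebra structure, induced by the
multiplication. Its laws may be tested after composition with `z` and with the image of `z` under
the square of the monad, which are epimorphisms. -/
theorem exists_algebra (hstable : ReflexiveCoequalizersPullbackStable C)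
    (hT : ∀ ⦃X Y : C⦄ (f g : X ⟶ Y) [IsReflexivePair f g],
      PreservesColimit (parallelPair f g) T.toFunctor)
    {Z W P : Over B.ob} {σ τ : W ⟶ B.free Z} {z : B.free Z ⟶ P}
    (h : IsReflexiveCoequalizer (bind σ) (bind τ) z) :
    ∃ a : B.free P ⟶ P, unit P ≫ a = 𝟙 P ∧ bind (𝟙 (B.free P)) ≫ a = freeMap a ≫ a ∧
      freeMap z ≫ a = bind (𝟙 (B.free Z)) ≫ z := by
  have h₁ := h.freeMap hstable hT
  have h₂ := h₁.freeMap hstable hT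
  have := h.epi
  have := h₂.epi
  obtain ⟨a, ha⟩ := h₁.exists_overDesc (bind (𝟙 (B.free Z)) ≫ z) (by
    have (ρ : W ⟶ B.free Z) : freeMap (bind ρ) ≫ bind (𝟙 (B.free Z)) =
        bind (𝟙 (B.free W)) ≫ bind ρ := by
      rw [freeMap_bind, bind_bind, Category.comp_id, Category.id_comp]
    rw [reassoc_of% (this σ), reassoc_of% (this τ), h.condition])
  have hu : z ≫ unit P = unit _ ≫ freeMap z := by rw [freeMap, unit_bind]
  refine ⟨a, ?_, ?_, ha⟩
  · rw [← cancel_epi z, reassoc_of% hu, ha, reassoc_of% @unit_bind,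
      Category.id_comp, Category.comp_id]
  · rw [← cancel_epi (freeMap (freeMap z)), ← Category.assoc, ← Category.assoc, freeMap_bind,
      ← freeMap_comp, ha, Category.comp_id, freeMap_comp, Category.assoc, ha, ← Category.assoc,
      freeMap_bind, Category.comp_id]
    have hb : bind (freeMap z) = bind (𝟙 (B.free (B.free Z))) ≫ freeMap z := by
      rw [freeMap, bind_bind, Category.id_comp]
    rw [hb, Category.assoc, ha, reassoc_of% @bind_bind, Category.id_comp]

end Coequalizer

/-! ### Comprehensive factorizations -/

noncomputable section Factorization

variable {A B : TCat T} (f : A ⟶ B)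

/-- The object of objects of `A`, over `B₀` by `f`. -/
abbrev obOver : Over B.ob := Over.mk f.f₀

/-- The object of morphisms of `A`, over `B₀` by the codomain and `f`. -/
abbrev morOver : Over B.ob := Over.mk (A.cod ≫ f.f₀)

/-- The codomain morphism of `A`, over `B₀`. -/
def codOver : morOver f ⟶ obOver f := Over.homMk A.cod

/-- The morphism `(d₀, f₁)` from `A₁` to `T A₀ ×_{T B₀} B₁`. -/
def domOver : morOver f ⟶ B.free (obOver f) :=
  Over.homMk (freeLift A.dom f.f₁ f.dom_comm) (by
    rw [← freeSnd_cod, reassoc_of% @freeLift_freeSnd, ← f.cod_comm]; rfl)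

@[simp]
theorem domOver_freeFst : (domOver f).left ≫ B.freeFst (obOver f) = A.dom :=
  freeLift_freeFst _ _ _

@[simp]
theorem domOver_freeSnd : (domOver f).left ≫ B.freeSnd (obOver f) = f.f₁ :=
  freeLift_freeSnd _ _ _

/-- The coequalizer that serves as the object of objects of the comprehensive factorization of `f`.
The common section is induced by the identities of `A`. -/
theorem exists_isReflexiveCoequalizer [HasReflexiveCoequalizers C] :
    ∃ (P : Over B.ob) (z : B.free (obOver f) ⟶ P),
      IsReflexiveCoequalizer (freeMap (codOver f)) (bind (domOver f)) z := by
  let i : obOver f ⟶ morOver f := Over.homMk A.ins (by simp [reassoc_of% A.ins_cod])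
  have h₁ : i ≫ codOver f = 𝟙 _ := by ext; exact A.ins_cod
  have h₂ : i ≫ domOver f = unit _ := by
    ext
    apply free_hom_ext
    · rw [Over.comp_left, Category.assoc, domOver_freeFst, unit_freeFst]
      exact A.ins_dom
    · rw [Over.comp_left, Category.assoc, domOver_freeSnd, unit_freeSnd]
      exact f.ins_comm
  have hs : ∃ r, r ≫ (freeMap (codOver f) : B.free _ ⟶ _) = 𝟙 _ ∧ r ≫ bind (domOver f) = 𝟙 _ := by
    refine ⟨freeMap i, ?_, ?_⟩
    · rw [← freeMap_comp, h₁, freeMap, Category.id_comp, bind_unit]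
    · rw [freeMap_bind, h₂, bind_unit]
  have : IsReflexivePair (freeMap (B := B) (codOver f)).left (bind (domOver f)).left := by
    obtain ⟨r, h₁, h₂⟩ := hs
    exact ⟨r.left, by rw [← Over.comp_left, h₁, Over.id_left],
      by rw [← Over.comp_left, h₂, Over.id_left]⟩
  have := HasReflexiveCoequalizers.has_coeq (freeMap (B := B) (codOver f)).left
    (bind (domOver f)).left
  refine ⟨Over.mk (coequalizer.desc (B.free (obOver f)).hom ?_),
    Over.homMk (coequalizer.π _ _) (coequalizer.π_desc _ _), hs, coequalizer.condition _ _,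
    ⟨coequalizerIsCoequalizer _ _⟩⟩
  rw [Over.w, Over.w]

/-- A morphism `x` into `D₁`, for a perfect `n : D ⟶ E`, turns the Kleisli extension into
composition in `D` as soon as its image in `E₁` does so in `E`: the domains agree anyway. -/
theorem bind_comp_eq_mul {Z W : Over B.ob} (h : Z ⟶ B.free W) {D E : TCat T} {n : D ⟶ E}
    (hn : Perfect T n) {α : W.left ⟶ D.ob} {x : (B.free W).left ⟶ D.mor}
    {y : (B.free Z).left ⟶ D.mor} {x' : (B.free W).left ⟶ E.mor}
    {y' : (B.free Z).left ⟶ E.mor} (hx' : x ≫ n.f₁ = x') (hy' : y ≫ n.f₁ = y')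
    (hx : x ≫ D.dom = B.freeFst W ≫ T.map α)
    (hy : (B.freeFst Z ≫ T.map (h.left ≫ x)) ≫ T.map D.cod = y ≫ D.dom)
    (hxy : (B.freeFst Z ≫ T.map (h.left ≫ x')) ≫ T.map E.cod = y' ≫ E.dom)
    (he : (bind h).left ≫ x' = E.mul (B.freeFst Z ≫ T.map (h.left ≫ x')) y' hxy) :
    (bind h).left ≫ x = D.mul (B.freeFst Z ≫ T.map (h.left ≫ x)) y hy := by
  apply IsPullback.hom_ext hn
  · rw [Category.assoc, hx, reassoc_of% @bind_freeFst, mul_dom, Category.assoc, ← T.map_comp_assoc,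
      Category.assoc, ← map_map_μ, ← T.map_comp_assoc, hx, Category.assoc]
  · subst hx' hy'
    rw [Category.assoc, he, mul_map]
    refine mul_congr ?_ rfl _
    rw [Category.assoc, ← T.map_comp, Category.assoc]

/-- If the object of objects of `P` is the coequalizer of the free algebras on the morphisms and
the objects of `A`, then `e : A ⟶ P` is initial: the fill-in of a square from `e` to a perfect
`n : D ⟶ E` is determined by, and constructed from, the morphism `T A₀ ×_{T B₀} B₁ ⟶ D₁` which
lifts the morphisms of `E` along `n`. Here `κ` is the comparison of the free algebra on the objects
of `A` with `P₁`, the quotient map is `κ` followed by the codomain, and `φ` is the image of the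
quotient map under the monad. -/
theorem initial_of_coequalizer {P : TCat T} (e : A ⟶ P) {p : P ⟶ B} (hp : Perfect T p)
    (hf : e ≫ p = f)
    {κ : (B.free (obOver f)).left ⟶ P.mor}
    (hκ₁ : κ ≫ P.dom = B.freeFst (obOver f) ≫ T.map e.f₀) (hκ₂ : κ ≫ p.f₁ = B.freeSnd (obOver f))
    [Epi (κ ≫ P.cod)]
    (hdesc : ∀ {Q : C} (k : (B.free (obOver f)).left ⟶ Q),
      (freeMap (B := B) (codOver f)).left ≫ k = (bind (domOver f)).left ≫ k →
        ∃ l : P.ob ⟶ Q, (κ ≫ P.cod) ≫ l = k)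
    {φ : (B.free (B.free (obOver f))).left ⟶ P.mor} [Epi φ]
    (hφ₁ : φ ≫ P.dom = B.freeFst (B.free (obOver f)) ≫ T.map (κ ≫ P.cod))
    (hφ₂ : φ ≫ p.f₁ = B.freeSnd (B.free (obOver f)))
    (hφ₃ : φ ≫ P.cod = (bind (𝟙 (B.free (obOver f)))).left ≫ κ ≫ P.cod) :
    Initial T e := by
  intro D E n hn a b hab
  have hab₀ : a.f₀ ≫ n.f₀ = e.f₀ ≫ b.f₀ := congrArg (fun g => g.f₀) hab
  have hab₁ : a.f₁ ≫ n.f₁ = e.f₁ ≫ b.f₁ := congrArg (fun g => g.f₁) hab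
  have hf₁ : e.f₁ ≫ p.f₁ = f.f₁ := congrArg (fun g => g.f₁) hf
  have hf₀ : e.f₀ ≫ p.f₀ = f.f₀ := congrArg (fun g => g.f₀) hf
  -- A family `α` of objects of `A` with `β` out of its image in `B` is sent to the lift along `n`,
  -- with domain the image of `α` in `D`, of the image in `E` of the morphism `κ (α, β)` of `P`.
  obtain ⟨x, hx₁, hx₂⟩ := IsPullback.exists_lift hn (B.freeFst (obOver f) ≫ T.map a.f₀)
    (κ ≫ b.f₁) (by
      rw [Category.assoc, Category.assoc, ← T.map_comp, ← b.dom_comm, reassoc_of% hκ₁, hab₀,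
        T.map_comp])
  -- Both `κ` and `x` turn the action of `B` into composition, `x` because `κ` does.
  have key {Z : Over B.ob} (h : Z ⟶ B.free (obOver f)) (y : (B.free Z).left ⟶ P.mor)
      (y' : (B.free Z).left ⟶ D.mor)
      (hy : (B.freeFst Z ≫ T.map (h.left ≫ κ)) ≫ T.map P.cod = y ≫ P.dom)
      (hy' : (B.freeFst Z ≫ T.map (h.left ≫ x)) ≫ T.map D.cod = y' ≫ D.dom)
      (hyp : y ≫ p.f₁ = B.freeSnd Z) (hyb : y' ≫ n.f₁ = y ≫ b.f₁) :
      (bind h).left ≫ x = D.mul (B.freeFst Z ≫ T.map (h.left ≫ x)) y' hy' := by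
    have hb : (bind h).left ≫ κ = P.mul (B.freeFst Z ≫ T.map (h.left ≫ κ)) y hy :=
      bind_comp_eq_mul h hp hκ₂ hyp hκ₁ hy (bind_aux h) (bind_freeSnd h)
    have hyb' : (B.freeFst Z ≫ T.map (h.left ≫ κ ≫ b.f₁)) ≫ T.map E.cod = (y ≫ b.f₁) ≫ E.dom := by
      rw [Category.assoc, ← T.map_comp, Category.assoc, Category.assoc, Category.assoc,
        ← b.cod_comm, ← b.dom_comm, ← reassoc_of% hy]
      simp only [T.map_comp, Category.assoc]
    refine bind_comp_eq_mul h hn hx₂ hyb hx₁ hy' hyb' ?_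
    rw [reassoc_of% hb, mul_map]
    refine mul_congr ?_ rfl _
    rw [Category.assoc, ← T.map_comp, Category.assoc]
  have hce : (domOver f).left ≫ κ = e.f₁ := by
    apply IsPullback.hom_ext hp
    · rw [Category.assoc, hκ₁, reassoc_of% @domOver_freeFst, e.dom_comm]
    · rw [Category.assoc, hκ₂, domOver_freeSnd, hf₁]
  have hcx : (domOver f).left ≫ x = a.f₁ := by
    apply IsPullback.hom_ext hn
    · rw [Category.assoc, hx₁, reassoc_of% @domOver_freeFst, a.dom_comm]
    · rw [Category.assoc, hx₂, reassoc_of% hce, hab₁]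
  obtain ⟨w₀, hw₀⟩ := hdesc (x ≫ D.cod) (by
    have := key (domOver f) ((freeMap (codOver f)).left ≫ κ) ((freeMap (codOver f)).left ≫ x)
      (by
        rw [hce, Category.assoc, ← T.map_comp, ← e.cod_comm, Category.assoc, hκ₁,
          reassoc_of% @freeMap_freeFst, T.map_comp]
        rfl)
      (by
        rw [hcx, Category.assoc, ← T.map_comp, ← a.cod_comm, Category.assoc, hx₁,
          reassoc_of% @freeMap_freeFst, T.map_comp]
        rfl)
      (by rw [Category.assoc, hκ₂, freeMap_freeSnd])
      (by rw [Category.assoc, hx₂, Category.assoc])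
    rw [reassoc_of% this, mul_cod, Category.assoc])
  rw [Category.assoc] at hw₀
  have hw₀n : w₀ ≫ n.f₀ = b.f₀ := by
    rw [← cancel_epi (κ ≫ P.cod), Category.assoc, reassoc_of% hw₀, n.cod_comm, reassoc_of% hx₂,
      ← b.cod_comm, Category.assoc]
  obtain ⟨w₁, hw₁, hw₁n⟩ := IsPullback.exists_lift hn (P.dom ≫ T.map w₀) b.f₁ (by
    rw [Category.assoc, ← T.map_comp, hw₀n, b.dom_comm])
  -- Compatibility with codomains is tested on the cover `φ` of `P₁`.
  have hcod : P.cod ≫ w₀ = w₁ ≫ D.cod := by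
    have := key (𝟙 (B.free (obOver f))) φ (φ ≫ w₁)
      (by rw [Over.id_left, Category.id_comp, Category.assoc, ← T.map_comp, hφ₁])
      (by
        rw [Over.id_left, Category.id_comp, Category.assoc, ← T.map_comp, ← hw₀, Category.assoc,
          hw₁, reassoc_of% hφ₁, T.map_comp, T.map_comp, T.map_comp, Category.assoc])
      hφ₂ (by rw [Category.assoc, hw₁n])
    rw [← cancel_epi φ, reassoc_of% hφ₃, hw₀, reassoc_of% this, mul_cod,
      Category.assoc]
  let w : P ⟶ D := homOfPerfect hn ⟨w₀, w₁, hw₁.symm, hcod⟩ b hw₀n hw₁n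
  have huκ : (unit (obOver f)).left ≫ κ = e.f₀ ≫ P.ins := by
    apply IsPullback.hom_ext hp
    · rw [Category.assoc, hκ₁, reassoc_of% @unit_freeFst, Category.assoc, P.ins_dom, comp_η]
    · rw [Category.assoc, hκ₂, unit_freeSnd, Category.assoc, p.ins_comm, reassoc_of% hf₀]
      rfl
  have hux : (unit (obOver f)).left ≫ x = a.f₀ ≫ D.ins := by
    apply IsPullback.hom_ext hn
    · rw [Category.assoc, hx₁, reassoc_of% @unit_freeFst, Category.assoc, D.ins_dom, comp_η]
    · rw [Category.assoc, hx₂, reassoc_of% huκ, b.ins_comm, Category.assoc, n.ins_comm,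
        reassoc_of% hab₀]
  have hew₀ : e.f₀ ≫ w₀ = a.f₀ := by
    have h₁ : (unit (obOver f)).left ≫ (κ ≫ P.cod) ≫ w₀ = e.f₀ ≫ w₀ := by
      rw [Category.assoc, reassoc_of% huκ, reassoc_of% P.ins_cod]
    rw [← h₁, Category.assoc, hw₀, reassoc_of% hux, D.ins_cod, Category.comp_id]
  refine ⟨w, ⟨hom_ext hew₀ ?_, hom_ext hw₀n hw₁n⟩, ?_⟩
  · apply IsPullback.hom_ext hn
    · change (e.f₁ ≫ w₁) ≫ D.dom = _
      rw [Category.assoc, hw₁, ← reassoc_of% e.dom_comm, ← T.map_comp, hew₀, a.dom_comm]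
    · change (e.f₁ ≫ w₁) ≫ n.f₁ = _
      rw [Category.assoc, hw₁n, hab₁]
  · rintro w' ⟨rfl, rfl⟩
    have hx' : κ ≫ w'.f₁ = x := by
      apply IsPullback.hom_ext hn
      · rw [hx₁, Category.assoc, ← w'.dom_comm, reassoc_of% hκ₁, comp_f₀, T.map_comp]
      · rw [hx₂, Category.assoc, comp_f₁]
    have h₀ : w'.f₀ = w₀ := by
      rw [← cancel_epi (κ ≫ P.cod), Category.assoc, Category.assoc, hw₀, ← hx', Category.assoc,
        w'.cod_comm]
    refine hom_ext h₀ (IsPullback.hom_ext hn ?_ ?_)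
    · change _ = w₁ ≫ D.dom
      rw [hw₁, ← w'.dom_comm, h₀]
    · exact hw₁n.symm

/-- Every `T`-functor has a comprehensive factorization. -/
theorem exists_comprehensive_factorization [HasReflexiveCoequalizers C]
    (hstable : ReflexiveCoequalizersPullbackStable C)
    (hT : ∀ ⦃X Y : C⦄ (f g : X ⟶ Y) [IsReflexivePair f g],
      PreservesColimit (parallelPair f g) T.toFunctor) :
    ∃ (P : TCat T) (e : A ⟶ P) (p : P ⟶ B), Initial T e ∧ Perfect T p ∧ e ≫ p = f := by
  obtain ⟨P, z, h⟩ := exists_isReflexiveCoequalizer f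
  obtain ⟨a, hη, hμ, ha⟩ := exists_algebra hstable hT h
  have he₀ : freeMap (unit (obOver f) ≫ z) ≫ a = z := by
    rw [freeMap_comp, Category.assoc, ha, ← Category.assoc, freeMap_bind, Category.comp_id,
      bind_unit, Category.id_comp]
  have hp := perfect_ofAlgebraProj a hη hμ
  let e₀ : A.ob ⟶ P.left := (unit (obOver f)).left ≫ z.left
  have he₀p : e₀ ≫ P.hom = f.f₀ := Over.w (unit (obOver f) ≫ z)
  let e₁ : A.mor ⟶ (B.free P).left := freeLift (A.dom ≫ T.map e₀) f.f₁ (by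
    rw [Category.assoc, ← T.map_comp, he₀p, f.dom_comm])
  have he₁ : e₁ = (domOver f).left ≫ (freeMap (unit (obOver f) ≫ z)).left := by
    apply free_hom_ext
    · rw [freeLift_freeFst, Category.assoc, freeMap_freeFst, reassoc_of% @domOver_freeFst]
      rfl
    · rw [freeLift_freeSnd, Category.assoc, freeMap_freeSnd, domOver_freeSnd]
  have hcod : A.cod ≫ e₀ = e₁ ≫ a.left := by
    have h₁ : domOver f ≫ z = codOver f ≫ unit _ ≫ z := by
      rw [← reassoc_of% unit_bind (domOver f), ← h.condition, freeMap,
        reassoc_of% @unit_bind, Category.assoc]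
    rw [he₁, Category.assoc, ← Over.comp_left, he₀]
    exact (congrArg (fun g => g.left) h₁).symm
  let e : A ⟶ ofAlgebra a hη hμ := homOfPerfect hp
    ⟨e₀, e₁, (freeLift_freeFst _ _ _).symm, hcod⟩ f he₀p (freeLift_freeSnd _ _ _)
  have hz : (freeMap (B := B) (unit (obOver f) ≫ z)).left ≫ a.left = z.left :=
    congrArg (fun g => g.left) he₀
  have hepi := h.epi_left
  have hepi' := (h.freeMap hstable hT).epi_left
  have hef : e ≫ ofAlgebraProj a hη hμ = f := hom_ext he₀p (freeLift_freeSnd _ _ _)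
  refine ⟨_, e, _, ?_, hp, hef⟩
  refine @initial_of_coequalizer _ _ _ _ _ _ f _ e _ hp hef
    (freeMap (unit (obOver f) ≫ z)).left (freeMap_freeFst _) (freeMap_freeSnd _)
    ?_ ?_ (freeMap z).left hepi' ?_ (freeMap_freeSnd _) ?_
  · exact hz ▸ hepi
  · exact hz ▸ h.exists_desc
  · exact hz ▸ freeMap_freeFst _
  · exact hz ▸ congrArg (fun g => g.left) ha

end Factorization

/-! ### Pullbacks of `T`-categories -/

noncomputable section Pullback

variable {A B E : TCat T} (f : A ⟶ E) (g : B ⟶ E)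

/-- The object of objects of the pullback. -/
abbrev pbOb : C := pullback f.f₀ g.f₀

/-- The pair of domains of a pair of morphisms with the same image in `E`. -/
def pbPairDom : pullback f.f₁ g.f₁ ⟶ pullback (T.map f.f₀) (T.map g.f₀) :=
  pullback.lift (pullback.fst f.f₁ g.f₁ ≫ A.dom) (pullback.snd f.f₁ g.f₁ ≫ B.dom) (by
    rw [Category.assoc, Category.assoc, f.dom_comm, g.dom_comm, pullback.condition_assoc])

/-- The comparison morphism from `T` of the pullback of objects to the pullback of its images. -/
def pbComparison : T.obj (pbOb f g) ⟶ pullback (T.map f.f₀) (T.map g.f₀) :=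
  pullback.lift (T.map (pullback.fst f.f₀ g.f₀)) (T.map (pullback.snd f.f₀ g.f₀)) (by
    rw [← T.map_comp, ← T.map_comp, pullback.condition])

theorem pbPairDom_fst : pbPairDom f g ≫ pullback.fst _ _ = pullback.fst _ _ ≫ A.dom :=
  pullback.lift_fst _ _ _

theorem pbPairDom_snd : pbPairDom f g ≫ pullback.snd _ _ = pullback.snd _ _ ≫ B.dom :=
  pullback.lift_snd _ _ _

theorem pbComparison_fst :
    pbComparison f g ≫ pullback.fst _ _ = T.map (pullback.fst f.f₀ g.f₀) :=
  pullback.lift_fst _ _ _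

theorem pbComparison_snd :
    pbComparison f g ≫ pullback.snd _ _ = T.map (pullback.snd f.f₀ g.f₀) :=
  pullback.lift_snd _ _ _

/-- The object of morphisms of the pullback. As `T` need not preserve pullbacks, a morphism of the
pullback is a pair of morphisms with the same image in `E` together with a common domain in
`T (A₀ ×_{E₀} B₀)`. -/
abbrev pbMor : C := pullback (pbPairDom f g) (pbComparison f g)

/-- The projection of the object of morphisms of the pullback to `A₁`. -/
def pbFst : pbMor f g ⟶ A.mor := pullback.fst _ _ ≫ pullback.fst _ _

/-- The projection of the object of morphisms of the pullback to `B₁`. -/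
def pbSnd : pbMor f g ⟶ B.mor := pullback.fst _ _ ≫ pullback.snd _ _

/-- The domain morphism of the pullback. -/
def pbDom : pbMor f g ⟶ T.obj (pbOb f g) := pullback.snd _ _

theorem pbFst_dom : pbFst f g ≫ A.dom = pbDom f g ≫ T.map (pullback.fst f.f₀ g.f₀) := by
  have := pullback.condition (f := pbPairDom f g) (g := pbComparison f g) =≫ pullback.fst _ _
  simp only [Category.assoc, pbPairDom_fst, pbComparison_fst] at this
  rw [pbFst, Category.assoc, this, pbDom]

theorem pbSnd_dom : pbSnd f g ≫ B.dom = pbDom f g ≫ T.map (pullback.snd f.f₀ g.f₀) := by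
  have := pullback.condition (f := pbPairDom f g) (g := pbComparison f g) =≫ pullback.snd _ _
  simp only [Category.assoc, pbPairDom_snd, pbComparison_snd] at this
  rw [pbSnd, Category.assoc, this, pbDom]

theorem pbFst_comp : pbFst f g ≫ f.f₁ = pbSnd f g ≫ g.f₁ := by
  rw [pbFst, pbSnd, Category.assoc, Category.assoc, pullback.condition]

variable {f g} in
theorem pb_hom_ext {X : C} {x y : X ⟶ pbMor f g} (h₁ : x ≫ pbFst f g = y ≫ pbFst f g)
    (h₂ : x ≫ pbSnd f g = y ≫ pbSnd f g) (h₃ : x ≫ pbDom f g = y ≫ pbDom f g) : x = y := by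
  refine pullback.hom_ext (pullback.hom_ext ?_ ?_) h₃
  · simpa [pbFst] using h₁
  · simpa [pbSnd] using h₂

theorem exists_pbLift {X : C} (a : X ⟶ A.mor) (b : X ⟶ B.mor) (d : X ⟶ T.obj (pbOb f g))
    (h : a ≫ f.f₁ = b ≫ g.f₁) (ha : a ≫ A.dom = d ≫ T.map (pullback.fst f.f₀ g.f₀))
    (hb : b ≫ B.dom = d ≫ T.map (pullback.snd f.f₀ g.f₀)) :
    ∃ l : X ⟶ pbMor f g, l ≫ pbFst f g = a ∧ l ≫ pbSnd f g = b ∧ l ≫ pbDom f g = d :=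
  ⟨pullback.lift (pullback.lift a b h) d (by
    apply pullback.hom_ext <;> simp [ha, hb, pbPairDom_fst, pbPairDom_snd,
      pbComparison_fst, pbComparison_snd]), by simp [pbFst], by simp [pbSnd],
    pullback.lift_snd _ _ _⟩

theorem exists_pbIns : ∃ l : pbOb f g ⟶ pbMor f g,
    l ≫ pbFst f g = pullback.fst _ _ ≫ A.ins ∧ l ≫ pbSnd f g = pullback.snd _ _ ≫ B.ins ∧
      l ≫ pbDom f g = T.η.app _ := by
  apply exists_pbLift
  · rw [Category.assoc, f.ins_comm, Category.assoc, g.ins_comm, pullback.condition_assoc]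
  · rw [Category.assoc, A.ins_dom]; exact comp_η _ _
  · rw [Category.assoc, B.ins_dom]; exact comp_η _ _

/-- The pointed `T`-graph of the pullback. -/
abbrev pbGraph : PointedTGraph T where
  ob := pbOb f g
  mor := pbMor f g
  dom := pbDom f g
  cod := pullback.lift (pbFst f g ≫ A.cod) (pbSnd f g ≫ B.cod) (by
    rw [Category.assoc, Category.assoc, f.cod_comm, g.cod_comm, reassoc_of% @pbFst_comp])
  ins := (exists_pbIns f g).choose
  ins_dom := (exists_pbIns f g).choose_spec.2.2
  ins_cod := by
    obtain ⟨h₁, h₂, -⟩ := (exists_pbIns f g).choose_spec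
    apply pullback.hom_ext
    · rw [Category.assoc, pullback.lift_fst, reassoc_of% h₁, A.ins_cod, Category.comp_id,
        Category.id_comp]
    · rw [Category.assoc, pullback.lift_snd, reassoc_of% h₂, B.ins_cod, Category.comp_id,
        Category.id_comp]

/-- The first projection of the pullback, on `T`-graphs. -/
abbrev pbGraphFst : TGraph.Hom (pbGraph f g).toTGraph A.toTGraph where
  f₀ := pullback.fst _ _
  f₁ := pbFst f g
  dom_comm := (pbFst_dom f g).symm
  cod_comm := pullback.lift_fst _ _ _

/-- The second projection of the pullback, on `T`-graphs. -/
abbrev pbGraphSnd : TGraph.Hom (pbGraph f g).toTGraph B.toTGraph where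
  f₀ := pullback.snd _ _
  f₁ := pbSnd f g
  dom_comm := (pbSnd_dom f g).symm
  cod_comm := pullback.lift_snd _ _ _

theorem exists_pbComp : ∃ l : (pbGraph f g).pairs ⟶ pbMor f g,
    l ≫ pbFst f g = (pbGraphFst f g).f₂ ≫ A.comp ∧
    l ≫ pbSnd f g = (pbGraphSnd f g).f₂ ≫ B.comp ∧
    l ≫ pbDom f g = (pbGraph f g).d₁ ≫ T.map (pbDom f g) ≫ T.μ.app _ := by
  apply exists_pbLift
  · rw [Category.assoc, Category.assoc, f.comp_comm, g.comp_comm, ← Category.assoc,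
      ← Category.assoc]
    congr 1
    apply pullback.hom_ext
    · rw [Category.assoc, Category.assoc, TGraph.Hom.f₂_d₁, TGraph.Hom.f₂_d₁,
        reassoc_of% @TGraph.Hom.f₂_d₁, reassoc_of% @TGraph.Hom.f₂_d₁, ← T.map_comp,
        ← T.map_comp, pbFst_comp]
    · rw [Category.assoc, Category.assoc, TGraph.Hom.f₂_c₁, TGraph.Hom.f₂_c₁,
        reassoc_of% @TGraph.Hom.f₂_c₁, reassoc_of% @TGraph.Hom.f₂_c₁, pbFst_comp]
  · rw [Category.assoc, A.comp_dom, reassoc_of% @TGraph.Hom.f₂_d₁, ← T.map_comp_assoc, pbFst_dom,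
      Category.assoc, Category.assoc, ← map_map_μ, T.map_comp_assoc]
  · rw [Category.assoc, B.comp_dom, reassoc_of% @TGraph.Hom.f₂_d₁, ← T.map_comp_assoc, pbSnd_dom,
      Category.assoc, Category.assoc, ← map_map_μ, T.map_comp_assoc]

/-- The pullback of `T`-categories. -/
def pb : TCat T where
  toPointedTGraph := pbGraph f g
  comp := (exists_pbComp f g).choose
  comp_dom := (exists_pbComp f g).choose_spec.2.2
  comp_cod := by
    obtain ⟨h₁, h₂, -⟩ := (exists_pbComp f g).choose_spec
    apply pullback.hom_ext
    · rw [Category.assoc, pullback.lift_fst, reassoc_of% h₁, A.comp_cod, Category.assoc,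
        pullback.lift_fst, reassoc_of% @TGraph.Hom.f₂_c₁]
    · rw [Category.assoc, pullback.lift_snd, reassoc_of% h₂, B.comp_cod, Category.assoc,
        pullback.lift_snd, reassoc_of% @TGraph.Hom.f₂_c₁]
  i₁_comp := by
    obtain ⟨h₁, h₂, h₃⟩ := (exists_pbComp f g).choose_spec
    obtain ⟨k₁, k₂, -⟩ := (exists_pbIns f g).choose_spec
    apply pb_hom_ext
    · exact (PointedTGraph.i₁_comp_map (pbGraphFst f g) k₁ h₁).trans (Category.id_comp _).symm
    · exact (PointedTGraph.i₁_comp_map (pbGraphSnd f g) k₂ h₂).trans (Category.id_comp _).symm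
    · exact (PointedTGraph.i₁_comp_dom _ _ h₃).trans (Category.id_comp _).symm
  i₂_comp := by
    obtain ⟨h₁, h₂, h₃⟩ := (exists_pbComp f g).choose_spec
    obtain ⟨k₁, k₂, -⟩ := (exists_pbIns f g).choose_spec
    apply pb_hom_ext
    · exact (PointedTGraph.i₂_comp_map (pbGraphFst f g) k₁ h₁).trans (Category.id_comp _).symm
    · exact (PointedTGraph.i₂_comp_map (pbGraphSnd f g) k₂ h₂).trans (Category.id_comp _).symm
    · exact (PointedTGraph.i₂_comp_dom _ _ h₃).trans (Category.id_comp _).symm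
  assoc := by
    obtain ⟨h₁, h₂, h₃⟩ := (exists_pbComp f g).choose_spec
    apply pb_hom_ext
    · exact TGraph.m₁_comp_map (pbGraphFst f g) h₁ _ _
    · exact TGraph.m₁_comp_map (pbGraphSnd f g) h₂ _ _
    · exact TGraph.m₁_comp_dom _ _

/-- The first projection of the pullback. -/
def pbProjFst : pb f g ⟶ A :=
  { pbGraphFst f g with
    ins_comm := (exists_pbIns f g).choose_spec.1
    comp_comm := (exists_pbComp f g).choose_spec.1 }

/-- The second projection of the pullback. -/
def pbProjSnd : pb f g ⟶ B :=
  { pbGraphSnd f g with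
    ins_comm := (exists_pbIns f g).choose_spec.2.1
    comp_comm := (exists_pbComp f g).choose_spec.2.1 }

variable {f g} in
theorem exists_pb_lift {X : TCat T} (a : X ⟶ A) (b : X ⟶ B) (h : a ≫ f = b ≫ g) :
    ∃ l : X ⟶ pb f g, l ≫ pbProjFst f g = a ∧ l ≫ pbProjSnd f g = b := by
  have h₀ : a.f₀ ≫ f.f₀ = b.f₀ ≫ g.f₀ := congrArg (fun k => k.f₀) h
  have h₁ : a.f₁ ≫ f.f₁ = b.f₁ ≫ g.f₁ := congrArg (fun k => k.f₁) h
  obtain ⟨l₁, ha, hb, hd⟩ := exists_pbLift f g a.f₁ b.f₁ (X.dom ≫ T.map (pullback.lift _ _ h₀)) h₁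
    (by rw [Category.assoc, ← T.map_comp, pullback.lift_fst, a.dom_comm])
    (by rw [Category.assoc, ← T.map_comp, pullback.lift_snd, b.dom_comm])
  let l : TGraph.Hom X.toTGraph (pbGraph f g).toTGraph :=
    { f₀ := pullback.lift _ _ h₀
      f₁ := l₁
      dom_comm := hd.symm
      cod_comm := by
        apply pullback.hom_ext
        · rw [Category.assoc, Category.assoc, pullback.lift_fst, pullback.lift_fst, a.cod_comm,
            reassoc_of% ha]
        · rw [Category.assoc, Category.assoc, pullback.lift_snd, pullback.lift_snd, b.cod_comm,
            reassoc_of% hb] }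
  refine ⟨{ l with ins_comm := ?_, comp_comm := ?_ }, hom_ext (pullback.lift_fst _ _ _) ha,
    hom_ext (pullback.lift_snd _ _ _) hb⟩
  · obtain ⟨k₁, k₂, k₃⟩ := (exists_pbIns f g).choose_spec
    change X.ins ≫ l₁ = pullback.lift _ _ h₀ ≫ (exists_pbIns f g).choose
    apply pb_hom_ext
    · rw [Category.assoc, ha, Category.assoc, k₁, pullback.lift_fst_assoc, a.ins_comm]
    · rw [Category.assoc, hb, Category.assoc, k₂, pullback.lift_snd_assoc, b.ins_comm]
    · rw [Category.assoc, hd, Category.assoc, k₃, reassoc_of% X.ins_dom]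
      exact (comp_η T _).symm
  · obtain ⟨k₁, k₂, k₃⟩ := (exists_pbComp f g).choose_spec
    change X.comp ≫ l₁ = l.f₂ ≫ (exists_pbComp f g).choose
    apply pb_hom_ext
    · rw [Category.assoc, ha, a.comp_comm, Category.assoc, k₁, ← Category.assoc]
      congr 1
      apply pullback.hom_ext
      · rw [a.f₂_d₁, Category.assoc, TGraph.Hom.f₂_d₁, reassoc_of% l.f₂_d₁, ← T.map_comp, ha]
      · rw [a.f₂_c₁, Category.assoc, TGraph.Hom.f₂_c₁, reassoc_of% l.f₂_c₁, ha]
    · rw [Category.assoc, hb, b.comp_comm, Category.assoc, k₂, ← Category.assoc]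
      congr 1
      apply pullback.hom_ext
      · rw [b.f₂_d₁, Category.assoc, TGraph.Hom.f₂_d₁, reassoc_of% l.f₂_d₁, ← T.map_comp, hb]
      · rw [b.f₂_c₁, Category.assoc, TGraph.Hom.f₂_c₁, reassoc_of% l.f₂_c₁, hb]
    · rw [Category.assoc, hd, Category.assoc, k₃, reassoc_of% l.f₂_d₁,
        reassoc_of% X.comp_dom, ← T.map_comp_assoc, hd, ← map_map_μ, T.map_comp_assoc]

theorem pb_isPullback : IsPullback (pbProjFst f g) (pbProjSnd f g) f g where
  w := hom_ext pullback.condition (pbFst_comp f g)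
  isLimit' := ⟨PullbackCone.IsLimit.mk _ (fun s => (exists_pb_lift s.fst s.snd s.condition).choose)
    (fun s => (exists_pb_lift s.fst s.snd s.condition).choose_spec.1)
    (fun s => (exists_pb_lift s.fst s.snd s.condition).choose_spec.2)
    (fun s l hl₁ hl₂ => by
      obtain ⟨k₁, k₂⟩ := (exists_pb_lift s.fst s.snd s.condition).choose_spec
      have e₁ := hl₁.trans k₁.symm
      have e₂ := hl₂.trans k₂.symm
      generalize (exists_pb_lift s.fst s.snd s.condition).choose = l' at e₁ e₂
      have h₀ : l.f₀ = l'.f₀ := pullback.hom_ext (congrArg (fun k => k.f₀) e₁)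
        (congrArg (fun k => k.f₀) e₂)
      refine hom_ext h₀ (pb_hom_ext (congrArg (fun k => k.f₁) e₁) (congrArg (fun k => k.f₁) e₂) ?_)
      exact l.dom_comm.symm.trans ((congrArg (fun k => s.pt.dom ≫ T.map k) h₀).trans l'.dom_comm))⟩

instance : HasPullbacks (TCat T) :=
  have (A B E : TCat T) (f : A ⟶ E) (g : B ⟶ E) : HasPullback f g := (pb_isPullback f g).hasPullback
  hasPullbacks_of_hasLimit_cospan _

variable {f g} in
theorem isOrdered_pb (hA : IsOrdered T A) (hB : IsOrdered T B) : IsOrdered T (pb f g) := by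
  intro X x y hd hc
  have key {D : TCat T} (q : pb f g ⟶ D) (hD : IsOrdered T D) : x ≫ q.f₁ = y ≫ q.f₁ := by
    apply hD
    · rw [Category.assoc, Category.assoc, ← q.dom_comm, reassoc_of% hd]
    · rw [Category.assoc, Category.assoc, ← q.cod_comm, reassoc_of% hc]
  exact pb_hom_ext (key (pbProjFst f g) hA) (key (pbProjSnd f g) hB) hd

end Pullback

/-! ### Closure properties of perfect and initial `T`-functors -/

section Classes

theorem perfect_of_isIso {A B : TCat T} (f : A ⟶ B) [IsIso f] : Perfect T f := by
  have h₀ : IsIso f.f₀ := ⟨(inv f).f₀, congrArg (fun k => k.f₀) (IsIso.hom_inv_id f),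
    congrArg (fun k => k.f₀) (IsIso.inv_hom_id f)⟩
  have h₁ : IsIso f.f₁ := ⟨(inv f).f₁, congrArg (fun k => k.f₁) (IsIso.hom_inv_id f),
    congrArg (fun k => k.f₁) (IsIso.inv_hom_id f)⟩
  exact IsPullback.of_vert_isIso ⟨f.dom_comm⟩

instance : (Perfect T).IsStableUnderComposition where
  comp_mem f g hf hg := by
    have := hf.paste_vert hg
    rwa [← T.map_comp] at this

instance : (Perfect T).RespectsIso :=
  MorphismProperty.respectsIso_of_isStableUnderComposition fun _ _ f hf =>
    have : IsIso f := hf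
    perfect_of_isIso f

instance : (Initial T).IsStableUnderComposition where
  comp_mem {X Y Z} e₁ e₂ h₁ h₂ := by
    intro D E n hn a b hab
    obtain ⟨w₁, ⟨hw₁, hw₁n⟩, hu₁⟩ := h₁ n hn a (e₂ ≫ b) (by rw [hab, Category.assoc])
    obtain ⟨w₂, ⟨hw₂, hw₂n⟩, hu₂⟩ := h₂ n hn w₁ b hw₁n
    refine ⟨w₂, ⟨by rw [Category.assoc, hw₂, hw₁], hw₂n⟩, fun w hw => hu₂ w ⟨hu₁ _ ⟨?_, ?_⟩, hw.2⟩⟩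
    · rw [← Category.assoc, hw.1]
    · rw [Category.assoc, hw.2]

instance : (Initial T).RespectsIso :=
  MorphismProperty.respectsIso_of_isStableUnderComposition fun _ _ e he => by
    have : IsIso e := he
    intro D E n _ a b hab
    refine ⟨inv e ≫ a, ⟨by simp, by simp [hab]⟩, fun w hw => by simp [← hw.1]⟩

end Classes

/-! ### Ordered `T`-categories -/

theorem isOrdered_of_isPullback {P A B E : TCat T} {p : P ⟶ A} {q : P ⟶ B} {f : A ⟶ E} {g : B ⟶ E}
    (h : IsPullback p q f g) (hA : IsOrdered T A) (hB : IsOrdered T B) : IsOrdered T P :=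
  isOrdered_of_perfect (perfect_of_isIso (h.isoIsPullback _ _ (pb_isPullback f g)).hom)
    (isOrdered_pb hA hB)

instance : (IsOrdered T).IsClosedUnderLimitsOfShape WalkingCospan where
  limitsOfShape_le := by
    rintro P ⟨h⟩
    exact isOrdered_of_isPullback (IsPullback.of_isLimit_cone h.isLimit)
      (h.prop_diag_obj .left) (h.prop_diag_obj .right)

/-- The comprehensive factorization restricts to `Ord(T)` by `isOrdered_of_perfect`. -/
theorem isOrthogonalFactorizationSystem_ord [HasReflexiveCoequalizers C]
    (hstable : ReflexiveCoequalizersPullbackStable C)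
    (hT : ∀ ⦃X Y : C⦄ (f g : X ⟶ Y) [IsReflexivePair f g],
      PreservesColimit (parallelPair f g) T.toFunctor) :
    IsOrthogonalFactorizationSystem ((Initial T).inverseImage (TOrd.incl T))
      ((Perfect T).inverseImage (TOrd.incl T)) where
  left_respectsIso := inferInstance
  right_respectsIso := inferInstance
  factorization {A B} f := by
    obtain ⟨P, e, p, he, hp, h⟩ := exists_comprehensive_factorization f.hom hstable hT
    exact ⟨⟨P, isOrdered_of_perfect hp B.property⟩, ObjectProperty.homMk e, ObjectProperty.homMk p,
      he, hp, (TOrd.incl T).map_injective h⟩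
  orthogonal e m he hm := by
    intro a b hab
    obtain ⟨w, ⟨h₁, h₂⟩, hw⟩ := he m.hom hm a.hom b.hom (congrArg (fun k => k.hom) hab)
    refine ⟨ObjectProperty.homMk w, ⟨(TOrd.incl T).map_injective h₁,
      (TOrd.incl T).map_injective h₂⟩, fun w' hw' => (TOrd.incl T).map_injective (hw _ ⟨?_, ?_⟩)⟩
    · exact congrArg (fun k => k.hom) hw'.1
    · exact congrArg (fun k => k.hom) hw'.2

end TCat
end Burroni

theorem mainTheorem9 {C : Type u} [Category.{v} C] [HasPullbacks C] [HasReflexiveCoequalizers C]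
    (hstable : Burroni.ReflexiveCoequalizersPullbackStable C)
    (T : CategoryTheory.Monad C)
    (hT : ∀ ⦃X Y : C⦄ (f g : X ⟶ Y) [IsReflexivePair f g],
      PreservesColimit (parallelPair f g) T.toFunctor) :
    -- every `T`-functor between ordered `T`-categories has a comprehensive factorization in
    -- `Cat(T)`, and each of its comprehensive factorizations runs through an ordered `T`-category
    (∀ ⦃A B : Burroni.TCat T⦄ (f : A ⟶ B),
      Burroni.TCat.IsOrdered T A → Burroni.TCat.IsOrdered T B →
        (∃ (P : Burroni.TCat T) (e : A ⟶ P) (p : P ⟶ B),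
          Burroni.TCat.Initial T e ∧ Burroni.TCat.Perfect T p ∧ e ≫ p = f) ∧
        (∀ (P : Burroni.TCat T) (e : A ⟶ P) (p : P ⟶ B),
          Burroni.TCat.Initial T e → Burroni.TCat.Perfect T p → e ≫ p = f →
            Burroni.TCat.IsOrdered T P)) ∧
    -- the comprehensive factorization restricts to an orthogonal factorization system of `Ord(T)`
    Burroni.IsOrthogonalFactorizationSystem
      ((Burroni.TCat.Initial T).inverseImage (Burroni.TOrd.incl T))
      ((Burroni.TCat.Perfect T).inverseImage (Burroni.TOrd.incl T)) ∧
    -- `Cat(T)` has pullbacks, and `Ord(T)` is closed under them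
    HasPullbacks (Burroni.TCat T) ∧
    (Burroni.TCat.IsOrdered T).IsClosedUnderLimitsOfShape WalkingCospan ∧
    -- a perfect `T`-functor with ordered codomain has ordered domain
    (∀ ⦃P B : Burroni.TCat T⦄ (p : P ⟶ B), Burroni.TCat.Perfect T p →
      Burroni.TCat.IsOrdered T B → Burroni.TCat.IsOrdered T P) := by
  exact ⟨fun A B f _ hB => ⟨Burroni.TCat.exists_comprehensive_factorization f hstable hT,
      fun P e p _ hp _ => Burroni.TCat.isOrdered_of_perfect hp hB⟩,
    Burroni.TCat.isOrthogonalFactorizationSystem_ord hstable hT, inferInstance, inferInstance,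
    fun _ _ _ hp hB => Burroni.TCat.isOrdered_of_perfect hp hB⟩
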